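/- **Model.** An access point serves clients $1,\dots,N$ in slotted time $t=0,1,2,\dots$, grouped into periods $[kT,(k+1)T)$, $T\ge 1$. The channel state $c_k$ is constant during period $k$; $(c_k)$ is a stationary irreducible Markov process on a finite set. At the beginning of period $k$ one packet arrives for each client in a set $S_k\subseteq\{1,\dots,N\}$, where $S_k$ is a function of the state of a stationary irreducible finite-state Markov process, independent of $(c_k)$. The packet of client $n$ is discarded if it is not delivered within the first $\tau_n\le T$ slots of its period. Transmissions are either at a fixed rate (one transmission per slot; under channel state $c$ a transmission to client $n$ is delivered with probability $p_{c,n}$, independently of the past) or rate-adaptive (an error-free transmission to client $n$ takes $s_{c,n}\ge 1$ slots). A *policy* decides, possibly at random, on the basis of all past observations, the current $c_k$ and $S_k$, and what has happened in the period so far, which available packet to transmit or to stay idle. A *priority-based policy* chooses at the beginning of each period, on the basis of the past and of $c_k,S_k$, possibly at random, a priority order of some of the clients; in the period it always transmits the packet of highest priority that has not been delivered (and idles if that packet has expired), so a packet is transmitted only after all packets of clients with higher priority have been delivered, and clients without a priority are never served. Let $\mathbb P$ be the set of priority-based policies. **Feasibility.** Let $d_n(t)$ be the number of packets delivered to client $n$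 up to slot $t$. For $q=[q_n]$ with all $q_n>0$, the clients are *fulfilled* under a policy if for every $\varepsilon>0$ $$\mathrm{Prob}\Big\{\tfrac{d_n(t)}{t/T}>q_n-\varepsilon\ \text{for every } n\Big\}\to 1\quad (t\to\infty).$$ For a class $\mathcal P$ of policies (all policies, or $\mathbb P$), $q$ is *strictly feasible in $\mathcal P$* if for some $\alpha\in(0,1)$ some policy in $\mathcal P$ fulfills $[q_n/\alpha]$. A scheduling policy (which may use $q$) is *feasibility optimal in $\mathcal P$* if it fulfills every $q$ that is strictly feasible in $\mathcal P$. **Pseudo-debt.** $r_n(k)$ is a *pseudo-debt* if (1) $r_n(0)=0$; (2) and (3) $r_n(k+1)=r_n(k)+z_n(q_n)-\mu_n(k)$, where $z_n$ is an increasing linear function (so $z_n(q_n)>0$), and $\mu_n(k)\ge 0$ is bounded and is given by a fixed function of the channel state and of the behavior of client $n$ in period $k$ (its arrival, its transmissions and its delivery), with $\mu_n(k)=0$ if nothing is transmitted for client $n$ in period $k$; (4) for every policy and every $q$, the clients are fulfilled if and only if $\mathrm{Prob}\{r_n(k)/k<\varepsilon\}\to 1$ as $k\to\infty$ for all $n$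 and all $\varepsilon>0$. **Theorem.** Let $r_n(k)$ be a pseudo-debt, and write $x^+=\max\{x,0\}$. 1. A policy that for every $q$, at the beginning of every period $k$, maximizes the payoff $$\sum_{n=1}^N E\{r_n(k)^+\mu_n(k)\mid c_k,S_k,[r_m(k)]\}$$ over all policies (with the same past before period $k$) is feasibility optimal in the class of all policies. 2. A priority-based policy that for every $q$, at the beginning of every period $k$, maximizes this payoff over all policies in $\mathbb P$ (with the same past before period $k$) is feasibility optimal in $\mathbb P$. -/

import Mathlib

open Filter Topology

noncomputable section

namespace Wireless

/-! ### Finite probability -/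

/-- Expectation of a real function under a probability mass function on a finite type. -/
def expect {α : Type*} [Fintype α] (p : PMF α) (f : α → ℝ) : ℝ :=
  ∑ a, (p a).toReal * f a

/-- Probability of an event. -/
def prob {α : Type*} [Fintype α] (p : PMF α) (E : Set α) : ℝ :=
  expect p (E.indicator fun _ => 1)

/-- Conditional expectation given an event (only used for events of positive probability). -/
def condExpect {α : Type*} [Fintype α] (p : PMF α) (f : α → ℝ) (E : Set α) : ℝ :=
  expect p (E.indicator f) / prob p E

/-- A coin that shows `true` with probability `x`. -/
def coin (x : unitInterval) : PMF Bool :=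
  PMF.ofFintype (fun b => if b then ENNReal.ofReal x else ENNReal.ofReal (1 - x)) (by
    have h0 : (0 : ℝ) ≤ x := x.2.1
    have h1 : (0 : ℝ) ≤ 1 - x := sub_nonneg.2 x.2.2
    simp [← ENNReal.ofReal_add h0 h1])

/-- Law of a pair with independent components. -/
def indep {α β : Type*} (p : PMF α) (q : PMF β) : PMF (α × β) :=
  p.bind fun a => q.map fun b => (a, b)

/-- A stationary, irreducible Markov process on a finite set of states: `init` is the law of the
state in the first period (hence in every period), `step` is the transition kernel. -/
structure StationaryChain (α : Type*) [Fintype α] where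
  init : PMF α
  step : α → PMF α
  stationary : init.bind step = init
  irreducible : (Matrix.of fun i j => (step i j).toReal).IsIrreducible

/-! ### The system -/

/-- How the access point transmits. Without rate adaptation a transmission takes one slot and,
under channel state `c`, is delivered to client `n` with probability `p c n`. With rate adaptation
an error-free transmission to client `n` under channel state `c` takes `s c n` slots. -/
inductive Transmission (N : ℕ) (C : Type*) where
  | fixedRate (p : C → Fin N → unitInterval)
  | rateAdaptation (s : C → Fin N → ℕ+)

/-- The number of slots that a transmission takes. -/
def Transmission.slots {N : ℕ} {C : Type*} : Transmission N C → C → Fin N → ℕ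
  | .fixedRate _, _, _ => 1
  | .rateAdaptation s, c, n => s c n

/-- The probability that a transmission which is carried to its end succeeds. -/
def Transmission.reliability {N : ℕ} {C : Type*} :
    Transmission N C → C → Fin N → unitInterval
  | .fixedRate p, c, n => p c n
  | .rateAdaptation _, _, _ => 1

/-- The wireless system with `N` clients: a period has `T` slots, client `n` has delay bound
`τ n`, the channel state of a period is in `C`, and packets arrive at the beginning of each period
for the clients in `arrive a`, where `a : A` is the state of the arrival process. The channel and
the arrival process are independent (see `envLaw`). -/
structure System (N : ℕ) (A C : Type*) [Fintype A] [Fintype C] where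
  T : ℕ
  T_pos : 0 < T
  τ : Fin N → ℕ
  τ_le : ∀ n, τ n ≤ T
  tx : Transmission N C
  channel : StationaryChain C
  arrivals : StationaryChain A
  arrive : A → Finset (Fin N)

variable {N : ℕ} {A C : Type*} [Fintype A] [Fintype C]

/-- What the access point does in the slots of one period: `none` is idle, `some (n, b)` is
transmitting for client `n`, where `b` says whether the packet is delivered (and acknowledged) at
the end of that slot. While a period is in progress the future slots are `none`. -/
abbrev Trace (M : System N A C) : Type := Fin M.T → Option (Fin N × Bool)

/-- A complete contingency plan for a period: the client to transmit for, if any, given the current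
slot and the trace of the period so far. -/
abbrev Plan (M : System N A C) : Type := Fin M.T → Trace M → Option (Fin N)

/-- The packet of client `n` has been delivered. -/
def Delivered (M : System N A C) (tr : Trace M) (n : Fin N) : Prop :=
  ∃ u, tr u = some (n, true)

instance (M : System N A C) (tr : Trace M) (n : Fin N) : Decidable (Delivered M tr n) :=
  inferInstanceAs (Decidable (∃ u, tr u = some (n, true)))

/-- In slot `s`, the packet of client `n` is in the system: it arrived, and it has neither expired
nor been delivered. -/
def Available (M : System N A C) (S : Finset (Fin N)) (s : ℕ) (tr : Trace M) (n : Fin N) : Prop :=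
  n ∈ S ∧ s < M.τ n ∧ ¬ Delivered M tr n

instance (M : System N A C) (S : Finset (Fin N)) (s : ℕ) (tr : Trace M) (n : Fin N) :
    Decidable (Available M S s tr n) :=
  inferInstanceAs (Decidable (n ∈ S ∧ s < M.τ n ∧ ¬ Delivered M tr n))

/-- Number of slots used by a transmission for client `n` that starts in slot `s`: it stops when
the packet expires. -/
def duration (M : System N A C) (c : C) (n : Fin N) (s : ℕ) : ℕ :=
  min (M.tx.slots c n) (M.τ n - s)

/-- The trace after a transmission for client `n` in the slots `s, …, s + d - 1`, with result
`b` in the last of these slots. -/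
def recordTx (M : System N A C) (tr : Trace M) (n : Fin N) (s d : ℕ) (b : Bool) : Trace M :=
  fun u => if s ≤ (u : ℕ) ∧ (u : ℕ) < s + d then some (n, b && decide ((u : ℕ) + 1 = s + d))
    else tr u

/-- Law of the final trace of a period when the plan `f` is followed from slot `s` on, the trace
so far being `tr`. Choosing a client without an available packet means to stay idle. Every step
uses at least one slot, so `fuel = M.T` steps reach the end of the period. -/
def runFrom (M : System N A C) (c : C) (S : Finset (Fin N)) (f : Plan M) :
    (fuel : ℕ) → (s : ℕ) → Trace M → PMF (Trace M)
  | 0, _, tr => PMF.pure tr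
  | fuel + 1, s, tr =>
    if hs : s < M.T then
      match f ⟨s, hs⟩ tr with
      | none => runFrom M c S f fuel (s + 1) tr
      | some n =>
        if Available M S s tr n then
          (coin (M.tx.reliability c n)).bind fun b =>
            runFrom M c S f fuel (s + duration M c n s)
              (recordTx M tr n s (duration M c n s)
                (b && decide (s + M.tx.slots c n ≤ M.τ n)))
        else runFrom M c S f fuel (s + 1) tr
    else PMF.pure tr

/-- Law of the trace of a period with channel state `c` and arrivals `S` under the plan `f`. -/
def run (M : System N A C) (c : C) (S : Finset (Fin N)) (f : Plan M) : PMF (Trace M) :=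
  runFrom M c S f M.T 0 fun _ => none

/-! ### Histories and scheduling policies -/

/-- Everything that happens in a period: arrival state, channel state, trace. -/
abbrev Outcome (M : System N A C) : Type _ := A × C × Trace M

/-- What the access point observes of a period: the clients with an arrival, the channel state,
and the trace. -/
abbrev Obs (M : System N A C) : Type _ := Finset (Fin N) × C × Trace M

/-- The observable part of an outcome. -/
def observe (M : System N A C) (o : Outcome M) : Obs M := (M.arrive o.1, o.2)

/-- A scheduling policy. At the beginning of period `k`, given all observations of the periods
`0, …, k - 1`, the channel state and the arrivals, it draws at random the plan for the period.
(Randomising over contingency plans allows every slot-by-slot randomisation.) -/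
structure Policy (M : System N A C) where
  plan : (k : ℕ) → (Fin k → Obs M) → C → Finset (Fin N) → PMF (Plan M)

/-- Joint law of arrival state and channel state in the next period. -/
def envLaw (M : System N A C) : {k : ℕ} → (Fin k → Outcome M) → PMF (A × C)
  | 0, _ => indep M.arrivals.init M.channel.init
  | k + 1, h => indep (M.arrivals.step (h (Fin.last k)).1) (M.channel.step (h (Fin.last k)).2.1)

/-- Law of the first `k` periods under the policy `η`. -/
def law (M : System N A C) (η : Policy M) : (k : ℕ) → PMF (Fin k → Outcome M)
  | 0 => PMF.pure Fin.elim0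
  | k + 1 =>
    (law M η k).bind fun h =>
      (envLaw M h).bind fun e =>
        (η.plan k (fun j => observe M (h j)) e.2 (M.arrive e.1)).bind fun f =>
          (run M e.2 (M.arrive e.1) f).map fun tr =>
            (Fin.snoc h (e.1, e.2, tr) : Fin (k + 1) → Outcome M)

/-- The plan that follows a priority order: in each free slot, look at the first client in the list
that has a packet arrival which has not been delivered, and transmit its packet (if it
has not expired). Clients outside the list are never served. -/
def priorityPlan (M : System N A C) (S : Finset (Fin N)) (order : List (Fin N)) : Plan M :=
  fun _ tr => order.find? fun n => decide (n ∈ S ∧ ¬ Delivered M tr n)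

/-- The class of priority-based policies: a (possibly random, history-dependent) priority order of
some of the clients is fixed at the beginning of each period and followed during the period. -/
def priorityPolicies (M : System N A C) : Set (Policy M) :=
  {η | ∀ k h c S, ∀ f ∈ (η.plan k h c S).support,
    ∃ order : List (Fin N), order.Nodup ∧ f = priorityPlan M S order}

/-! ### Fulfilment and feasibility -/

/-- `d_n(t)`: the number of packets delivered to client `n` in the slots before `t`. -/
def deliveries (M : System N A C) {k : ℕ} (h : Fin k → Outcome M) (n : Fin N) (t : ℕ) : ℕ :=
  (Finset.univ.filter fun x : Fin k × Fin M.T =>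
    (x.1 : ℕ) * M.T + (x.2 : ℕ) < t ∧ (h x.1).2.2 x.2 = some (n, true)).card

/-- The clients with timely-throughput requirements `q` are fulfilled under `η`. (The first `t`
slots lie in the first `t / T + 1` periods.) -/
def Fulfilled (M : System N A C) (η : Policy M) (q : Fin N → ℝ) : Prop :=
  ∀ ε : ℝ, 0 < ε → Tendsto (fun t : ℕ => prob (law M η (t / M.T + 1))
    {h | ∀ n, q n - ε < (deliveries M h n t : ℝ) / ((t : ℝ) / (M.T : ℝ))}) atTop (𝓝 1)

/-- `q` is feasible in the class `P` of policies. -/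
def Feasible (M : System N A C) (P : Set (Policy M)) (q : Fin N → ℝ) : Prop :=
  ∃ η ∈ P, Fulfilled M η q

/-- `q` is strictly feasible in the class `P`. -/
def StrictlyFeasible (M : System N A C) (P : Set (Policy M)) (q : Fin N → ℝ) : Prop :=
  ∃ α : ℝ, 0 < α ∧ α < 1 ∧ Feasible M P fun n => q n / α

/-- A scheduling rule (which may use the requirements `q`) is feasibility optimal among `P` if it
fulfills all clients whose requirements are strictly feasible in `P`. -/
def FeasibilityOptimal (M : System N A C) (P : Set (Policy M)) (η : (Fin N → ℝ) → Policy M) :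
    Prop :=
  ∀ q : Fin N → ℝ, (∀ n, 0 < q n) → StrictlyFeasible M P q → Fulfilled M (η q) q

/-! ### Pseudo-debts and the payoff -/

/-- The behavior of one client in a period: whether its packet arrived, and for every slot whether
the access point transmits for the client (`some`) and whether its packet is then delivered. -/
abbrev Behavior (M : System N A C) : Type := Bool × (Fin M.T → Option Bool)

/-- The behavior of client `n` in an observed period. -/
def behavior (M : System N A C) (o : Obs M) (n : Fin N) : Behavior M :=
  (decide (n ∈ o.1), fun s => match o.2.2 s with
    | none => none
    | some (m, b) => if m = n then some b else none)

/-- The rule giving the decrease of the debt of each client in a period from the channel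
state and the behavior of the client in that period. -/
abbrev Decrease (M : System N A C) : Type _ := Fin N → C → Behavior M → ℝ

/-- `μ_n(k)` as a function of what is observed in period `k`. -/
def decrease (M : System N A C) (μ : Decrease M) (n : Fin N) (o : Obs M) : ℝ :=
  μ n o.2.1 (behavior M o n)

/-- The debt `r_n(k)` after the observed history of the periods `0, …, k - 1`. -/
def debt (M : System N A C) (z : Fin N → ℝ →ₗ[ℝ] ℝ) (μ : Decrease M) (q : Fin N → ℝ)
    (n : Fin N) : {k : ℕ} → (Fin k → Obs M) → ℝ
  | 0, _ => 0
  | k + 1, h => debt M z μ q n (Fin.init h) + z n (q n) - decrease M μ n (h (Fin.last k))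

/-- The debts with increments `z_n(q_n)` and decreases `μ_n(k)` are pseudo-debts. -/
structure IsPseudoDebt (M : System N A C) (z : Fin N → ℝ →ₗ[ℝ] ℝ) (μ : Decrease M) : Prop where
  increasing : ∀ n, StrictMono (z n)
  nonneg : ∀ n c x, 0 ≤ μ n c x
  bounded : ∃ B : ℝ, ∀ n c x, μ n c x ≤ B
  idle : ∀ n c a, μ n c (a, fun _ => none) = 0
  fulfilled_iff : ∀ (η : Policy M) (q : Fin N → ℝ), (∀ n, 0 < q n) →
    (Fulfilled M η q ↔ ∀ n, ∀ ε : ℝ, 0 < ε →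
      Tendsto (fun k : ℕ => prob (law M η k)
        {h | debt M z μ q n (fun j => observe M (h j)) / (k : ℝ) < ε}) atTop (𝓝 1))

/-- The event that in period `k` the channel state is `c`, packets arrive for `S`, and the debt
vector at the beginning of the period is `ρ`. -/
def stateEvent (M : System N A C) (z : Fin N → ℝ →ₗ[ℝ] ℝ) (μ : Decrease M) (q : Fin N → ℝ)
    (k : ℕ) (c : C) (S : Finset (Fin N)) (ρ : Fin N → ℝ) : Set (Fin (k + 1) → Outcome M) :=
  {h | (h (Fin.last k)).2.1 = c ∧ M.arrive (h (Fin.last k)).1 = S ∧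
    ∀ n, debt M z μ q n (Fin.init fun j => observe M (h j)) = ρ n}

/-- The payoff `∑ₙ E{r_n(k)⁺ μ_n(k) | c_k = c, S_k = S, [r_m(k)] = ρ}` under the policy `η`. -/
def payoff (M : System N A C) (z : Fin N → ℝ →ₗ[ℝ] ℝ) (μ : Decrease M) (q : Fin N → ℝ)
    (η : Policy M) (k : ℕ) (c : C) (S : Finset (Fin N)) (ρ : Fin N → ℝ) : ℝ :=
  ∑ n, condExpect (law M η (k + 1))
    (fun h => max (debt M z μ q n (Fin.init fun j => observe M (h j))) 0 *
      decrease M μ n (observe M (h (Fin.last k))))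
    (stateEvent M z μ q k c S ρ)

/-- `η` is in `P` and in each period `k`, whatever the channel state, the arrivals and the debts
at its beginning, it maximizes the payoff over all policies in `P` with the same past, that is,
those that act as `η` does before period `k`. -/
def MaximizesPayoff (M : System N A C) (P : Set (Policy M)) (z : Fin N → ℝ →ₗ[ℝ] ℝ)
    (μ : Decrease M) (q : Fin N → ℝ) (η : Policy M) : Prop :=
  η ∈ P ∧ ∀ k : ℕ, ∀ η' ∈ P, (∀ j < k, η'.plan j = η.plan j) →
    ∀ (c : C) (S : Finset (Fin N)) (ρ : Fin N → ℝ),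
      0 < prob (law M η (k + 1)) (stateEvent M z μ q k c S ρ) →
      payoff M z μ q η' k c S ρ ≤ payoff M z μ q η k c S ρ

end Wireless

end

/-!
The proof is a Lyapunov argument for the sum of the squares of the positive parts `r_n⁺` of the
debts. Both classes of policies are determined by the plans `Pl S` that they allow in a single
period (`policiesUsing`), so both parts are instances of `feasibilityOptimal_policiesUsing`.

For weights `w` let `ψ_w(e)` be the best expected reward `∑ₙ wₙ μₙ` in a period with environment
`e` (arrival state and channel state), and let `P` be the Markov operator of the environment.
The environment is not influenced by the policy, so if the first period has environment `e`, then
no policy of the class earns more than `(P^j ψ_w)(e)` in period `j`. Some policy fulfills `q / α`,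
and `z_n(q_n) < z_n(q_n / α)`; since every environment has positive probability in the first
period, this gives one horizon `m` with `m ∑ₙ wₙ z_n(q_n) ≤ ∑_{j<m} (P^j ψ_w)(e)` for all `w ≥ 0`
and all `e` (`exists_horizon`). Neither joint irreducibility of the environment nor a limiting
stationary policy is needed.

A policy that maximizes the payoff earns at least the expectation of `ψ_{r⁺(k)}` in period `k`, as
is seen by comparison with the policy that plays a best plan in period `k` only
(`expect_envReward_le_expect_lastGain`). Debts have bounded increments and `ψ_w` is Lipschitz in
`w`, so over the next `m` periods the weights may be frozen at a bounded cost
(`frozenReward_succ_le`). By the choice of `m`, the Lyapunov function then increases by at most a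
constant over `m` periods. Hence `E ∑ₙ r_n⁺(k)² = O(k)`, and Chebyshev's inequality gives
`r_n(k) / k < ε` with probability tending to `1`.
-/

noncomputable section

namespace Wireless

/-! ### Finite probability -/

section FiniteExpectation

variable {α β : Type*} [Fintype α] [Fintype β]

lemma sum_toReal_eq_one (p : PMF α) : ∑ a, (p a).toReal = 1 := by
  rw [← ENNReal.toReal_sum fun a _ => p.apply_ne_top a, ← tsum_fintype (L := .unconditional _),
    p.tsum_coe, ENNReal.toReal_one]

lemma expect_pure (a : α) (f : α → ℝ) : expect (PMF.pure a) f = f a := by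
  classical
  simp [expect, PMF.pure_apply, apply_ite ENNReal.toReal]

lemma expect_bind (p : PMF α) (k : α → PMF β) (f : β → ℝ) :
    expect (p.bind k) f = expect p fun a => expect (k a) f := by
  have h (b : β) : ((p.bind k) b).toReal = ∑ a, (p a).toReal * (k a b).toReal := by
    rw [PMF.bind_apply, tsum_fintype,
      ENNReal.toReal_sum fun a _ => ENNReal.mul_ne_top (p.apply_ne_top a) ((k a).apply_ne_top b)]
    simp
  simp only [expect, h, Finset.sum_mul, Finset.mul_sum]
  rw [Finset.sum_comm]
  simp only [mul_assoc]

lemma expect_map (p : PMF α) (g : α → β) (f : β → ℝ) :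
    expect (p.map g) f = expect p fun a => f (g a) := by
  rw [PMF.map, expect_bind]
  simp [expect_pure]

lemma expect_const (p : PMF α) (x : ℝ) : (expect p fun _ => x) = x := by
  simp [expect, ← Finset.sum_mul, sum_toReal_eq_one]

lemma expect_add (p : PMF α) (f g : α → ℝ) :
    (expect p fun a => f a + g a) = expect p f + expect p g := by
  simp [expect, mul_add, Finset.sum_add_distrib]

lemma expect_sub (p : PMF α) (f g : α → ℝ) :
    (expect p fun a => f a - g a) = expect p f - expect p g := by
  simp [expect, mul_sub, Finset.sum_sub_distrib]

lemma expect_const_mul (p : PMF α) (x : ℝ) (f : α → ℝ) :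
    (expect p fun a => x * f a) = x * expect p f := by
  simp only [expect, Finset.mul_sum]
  exact Finset.sum_congr rfl fun a _ => by ring

lemma expect_sum {ι : Type*} (s : Finset ι) (p : PMF α) (f : ι → α → ℝ) :
    (expect p fun a => ∑ i ∈ s, f i a) = ∑ i ∈ s, expect p (f i) := by
  simp only [expect, Finset.mul_sum]
  exact Finset.sum_comm

lemma expect_mono_of_support {p : PMF α} {f g : α → ℝ} (h : ∀ a ∈ p.support, f a ≤ g a) :
    expect p f ≤ expect p g := by
  refine Finset.sum_le_sum fun a _ => ?_
  by_cases ha : a ∈ p.support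
  · exact mul_le_mul_of_nonneg_left (h a ha) ENNReal.toReal_nonneg
  · simp [(p.apply_eq_zero_iff a).2 ha]

lemma expect_mono {p : PMF α} {f g : α → ℝ} (h : ∀ a, f a ≤ g a) : expect p f ≤ expect p g :=
  expect_mono_of_support fun a _ => h a

lemma expect_nonneg {p : PMF α} {f : α → ℝ} (h : ∀ a, 0 ≤ f a) : 0 ≤ expect p f :=
  Finset.sum_nonneg fun a _ => mul_nonneg ENNReal.toReal_nonneg (h a)

lemma prob_le_one (p : PMF α) (E : Set α) : prob p E ≤ 1 := by
  rw [← expect_const p 1]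
  exact expect_mono (Set.indicator_le_self' fun _ _ => zero_le_one)

/-- On an event of probability zero every expectation vanishes. -/
lemma expect_indicator_eq_zero {p : PMF α} {E : Set α} (hE : prob p E = 0) (f : α → ℝ) :
    expect p (E.indicator f) = 0 := by
  have h : ∀ a ∈ Finset.univ, (p a).toReal * E.indicator (fun _ => (1 : ℝ)) a = 0 :=
    (Finset.sum_eq_zero_iff_of_nonneg fun a _ => mul_nonneg ENNReal.toReal_nonneg
      (Set.indicator_nonneg (f := fun _ => (1 : ℝ)) (fun _ _ => zero_le_one) a)).1 hE
  refine Finset.sum_eq_zero fun a ha => ?_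
  have h1 := h a ha
  by_cases hae : a ∈ E
  · rw [Set.indicator_of_mem hae, mul_one] at h1
    rw [h1, zero_mul]
  · simp [hae]

/-- An expectation is the sum of its parts over the fibers of a function `g`. -/
lemma expect_eq_sum_fiber {κ : Type*} [DecidableEq κ] (p : PMF α) (g : α → κ) (f : α → ℝ) :
    expect p f = ∑ y ∈ Finset.univ.image g, expect p ({a | g a = y}.indicator f) := by
  rw [← expect_sum]
  congr 1
  funext a
  rw [Finset.sum_eq_single (g a)]
  · simp
  · intro y _ hy
    simp [Set.indicator, Ne.symm hy]
  · simp

/-- Chebyshev's inequality for the positive part of a random variable. -/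
lemma one_sub_le_prob_lt (p : PMF α) (f : α → ℝ) {t : ℝ} (ht : 0 < t) :
    1 - (expect p fun a => max (f a) 0 ^ 2) / t ^ 2 ≤ prob p {a | f a < t} := by
  have h : (expect p fun a => 1 - (t ^ 2)⁻¹ * max (f a) 0 ^ 2) ≤ prob p {a | f a < t} := by
    refine expect_mono fun a => ?_
    by_cases ha : f a < t
    · have : 0 ≤ (t ^ 2)⁻¹ * max (f a) 0 ^ 2 := by positivity
      simp only [Set.indicator, Set.mem_ofPred_eq, ha, if_true]
      linarith
    · have h1 : t ≤ max (f a) 0 := (not_lt.1 ha).trans (le_max_left _ _)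
      have h2 : t ^ 2 ≤ max (f a) 0 ^ 2 := pow_le_pow_left₀ ht.le h1 2
      have h3 : 1 ≤ (t ^ 2)⁻¹ * max (f a) 0 ^ 2 := by
        rw [inv_mul_eq_div, one_le_div (by positivity)]
        exact h2
      simp only [Set.indicator, Set.mem_ofPred_eq, ha, if_false]
      linarith
  rwa [expect_sub, expect_const, expect_const_mul, inv_mul_eq_div] at h

lemma expect_indep (p : PMF α) (q : PMF β) (f : α × β → ℝ) :
    expect (indep p q) f = expect p fun a => expect q fun b => f (a, b) := by
  simp [indep, expect_bind, expect_map]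

lemma indep_apply_toReal (p : PMF α) (q : PMF β) (e : α × β) :
    (indep p q e).toReal = (p e.1).toReal * (q e.2).toReal := by
  classical
  have h : (indep p q e).toReal = expect (indep p q) fun x => if x = e then 1 else 0 := by
    simp [expect]
  rw [h, expect_indep]
  simp [expect, Prod.ext_iff, ite_and]

/-- Every state of an irreducible stationary chain has positive probability. -/
lemma StationaryChain.init_pos (X : StationaryChain α) (i : α) : 0 < (X.init i).toReal := by
  classical
  set Q : Matrix α α ℝ := Matrix.of fun i j => (X.step i j).toReal with hQ
  have hQ0 : ∀ i j, 0 ≤ Q i j := fun i j => ENNReal.toReal_nonneg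
  set v : α → ℝ := fun i => (X.init i).toReal with hv
  have hstat : Matrix.vecMul v Q = v := by
    funext j
    have h := expect_bind X.init X.step fun b => if b = j then 1 else 0
    rw [X.stationary] at h
    simpa [expect, Matrix.vecMul, dotProduct, hv, hQ] using h.symm
  have hpow (k : ℕ) : Matrix.vecMul v (Q ^ k) = v := by
    induction k with
    | zero => simp
    | succ k ih => rw [pow_succ, ← Matrix.vecMul_vecMul, ih, hstat]
  obtain ⟨j, hj⟩ := X.init.support_nonempty
  have hj' : 0 < v j := ENNReal.toReal_pos hj (X.init.apply_ne_top j)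
  obtain ⟨k, _, hk⟩ := (Matrix.isIrreducible_iff_exists_pow_pos hQ0).1 X.irreducible j i
  have hi : v i = ∑ l, v l * (Q ^ k) l i := (congrFun (hpow k) i).symm
  change 0 < v i
  rw [hi]
  have hnn : ∀ l, 0 ≤ v l * (Q ^ k) l i := fun l =>
    mul_nonneg ENNReal.toReal_nonneg (Matrix.pow_apply_nonneg hQ0 k l i)
  exact Finset.sum_pos' (fun l _ => hnn l) ⟨j, Finset.mem_univ j, mul_pos hj' hk⟩

end FiniteExpectation

variable {N : ℕ} {A C : Type*} [Fintype A] [Fintype C]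

/-! ### The law of the environment -/

section Environment

/-- Arrival state and channel state of a period. -/
def env (M : System N A C) (o : Outcome M) : A × C := (o.1, o.2.1)

/-- The Markov operator of the environment: the expectation of `φ` at the environment of the next
period, given that of the current one. -/
def envOp (M : System N A C) (φ : A × C → ℝ) (e : A × C) : ℝ :=
  expect (indep (M.arrivals.step e.1) (M.channel.step e.2)) φ

lemma envOp_iterate_le_add (M : System N A C) {φ ψ : A × C → ℝ} {x : ℝ}
    (h : ∀ e, φ e ≤ ψ e + x) (i : ℕ) (e : A × C) :
    (envOp M)^[i] φ e ≤ (envOp M)^[i] ψ e + x := by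
  induction i generalizing e with
  | zero => exact h e
  | succ i ih =>
    simp only [Function.iterate_succ_apply']
    calc _ ≤ expect _ fun e => (envOp M)^[i] ψ e + x := expect_mono ih
      _ = _ := by rw [expect_add, expect_const]; rfl

lemma expect_law_succ (M : System N A C) (η : Policy M) (k : ℕ)
    (F : (Fin (k + 1) → Outcome M) → ℝ) :
    expect (law M η (k + 1)) F =
      expect (law M η k) fun h => expect (envLaw M h) fun e =>
        expect (η.plan k (fun j => observe M (h j)) e.2 (M.arrive e.1)) fun f =>
          expect (run M e.2 (M.arrive e.1) f) fun tr =>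
            F (Fin.snoc h (e.1, e.2, tr) : Fin (k + 1) → Outcome M) := by
  simp only [law, expect_bind, expect_map]

lemma expect_law_env (M : System N A C) (η : Policy M) (k : ℕ)
    (φ : (Fin k → Outcome M) → A × C → ℝ) :
    (expect (law M η (k + 1)) fun h => φ (Fin.init h) (env M (h (Fin.last k)))) =
      expect (law M η k) fun h => expect (envLaw M h) (φ h) := by
  simp only [expect_law_succ, Fin.init_snoc, Fin.snoc_last, env, expect_const]

lemma expect_law_init (M : System N A C) (η : Policy M) (k : ℕ)
    (F : (Fin k → Outcome M) → ℝ) :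
    (expect (law M η (k + 1)) fun h => F (Fin.init h)) = expect (law M η k) F := by
  rw [expect_law_env M η k fun h _ => F h]
  simp only [expect_const]

lemma envLaw_eq_step (M : System N A C) {k : ℕ} (h : Fin (k + 1) → Outcome M)
    (φ : A × C → ℝ) :
    expect (envLaw M h) φ = envOp M φ (env M (h (Fin.last k))) := rfl

lemma law_congr (M : System N A C) {η η' : Policy M} {k : ℕ}
    (h : ∀ j < k, η'.plan j = η.plan j) : law M η' k = law M η k := by
  induction k with
  | zero => rfl
  | succ k ih => simp only [law, ih fun j hj => h j (hj.trans k.lt_succ_self), h k k.lt_succ_self]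

/-- The probability that the environment is in a given state in the first period. -/
def envProb (M : System N A C) (e : A × C) : ℝ := (indep M.arrivals.init M.channel.init e).toReal

lemma envProb_pos (M : System N A C) (e : A × C) : 0 < envProb M e := by
  rw [envProb, indep_apply_toReal]
  exact mul_pos (M.arrivals.init_pos _) (M.channel.init_pos _)

open Classical in
/-- The indicator function of the histories whose first period has environment `e`; it is `1` on
the empty history. -/
def startsIn (M : System N A C) (e : A × C) {k : ℕ} (h : Fin k → Outcome M) : ℝ :=
  if ∀ i : Fin k, (i : ℕ) = 0 → env M (h i) = e then 1 else 0

lemma startsIn_nonneg (M : System N A C) (e : A × C) {k : ℕ} (h : Fin k → Outcome M) :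
    0 ≤ startsIn M e h := by
  unfold startsIn
  split_ifs <;> norm_num

open Classical in
lemma startsIn_one (M : System N A C) (e : A × C) (h : Fin (0 + 1) → Outcome M) :
    startsIn M e h = if env M (h (Fin.last 0)) = e then 1 else 0 := by
  have : (∀ i : Fin (0 + 1), (i : ℕ) = 0 → env M (h i) = e) ↔ env M (h (Fin.last 0)) = e := by
    simp [Fin.last]
  simp only [startsIn, this]

lemma startsIn_succ (M : System N A C) (e : A × C) {k : ℕ} (h : Fin (k + 2) → Outcome M) :
    startsIn M e h = startsIn M e (Fin.init h) := by
  have : (∀ i : Fin (k + 2), (i : ℕ) = 0 → env M (h i) = e) ↔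
      ∀ i : Fin (k + 1), (i : ℕ) = 0 → env M (Fin.init h i) = e := by
    refine ⟨fun H i hi => H _ hi, fun H i hi => ?_⟩
    have := H 0 rfl
    have hi' : i = 0 := Fin.ext hi
    rw [hi']
    exact this
  classical
  unfold startsIn
  exact if_congr this rfl rfl

/-- The environment is a Markov chain which no policy influences. -/
lemma expect_startsIn_mul_env (M : System N A C) (η : Policy M) (e : A × C) (j : ℕ)
    (φ : A × C → ℝ) :
    (expect (law M η (j + 1)) fun h => startsIn M e h * φ (env M (h (Fin.last j)))) =
      envProb M e * (envOp M)^[j] φ e := by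
  classical
  induction j generalizing φ with
  | zero =>
    simp only [startsIn_one]
    rw [expect_law_env M η 0 fun _ e' => (if e' = e then 1 else 0) * φ e']
    rw [show law M η 0 = PMF.pure Fin.elim0 from rfl, expect_pure]
    simp [expect, envProb, envLaw]
  | succ j ih =>
    simp only [startsIn_succ]
    rw [expect_law_env M η (j + 1) fun h e' => startsIn M e h * φ e']
    simp only [expect_const_mul, envLaw_eq_step]
    rw [ih, Function.iterate_succ_apply]

lemma expect_startsIn (M : System N A C) (η : Policy M) (e : A × C) (j : ℕ) :
    expect (law M η (j + 1)) (startsIn M e) = envProb M e := by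
  have h := expect_startsIn_mul_env M η e j fun _ => 1
  have h1 : (envOp M)^[j] (fun _ => 1) = fun _ => 1 :=
    Function.iterate_fixed (funext fun e => expect_const _ _) j
  simpa only [h1, mul_one] using h

end Environment

/-! ### The best reward in a period -/

section Reward

/-- The expected weighted decrease `∑ₙ wₙ μₙ` in a period with channel state `c` and arrivals `S`
in which the plan `f` is followed. -/
def reward (M : System N A C) (μ : Decrease M) (w : Fin N → ℝ) (c : C) (S : Finset (Fin N))
    (f : Plan M) : ℝ :=
  expect (run M c S f) fun tr => ∑ n, w n * decrease M μ n (S, c, tr)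

/-- The largest expected weighted decrease in a period among the plans allowed by `Pl`. -/
def bestReward (M : System N A C) (μ : Decrease M) (Pl : Finset (Fin N) → Set (Plan M))
    (w : Fin N → ℝ) (c : C) (S : Finset (Fin N)) : ℝ :=
  ⨆ f : Pl S, reward M μ w c S f

/-- The best reward as a function of the environment. -/
def envReward (M : System N A C) (μ : Decrease M) (Pl : Finset (Fin N) → Set (Plan M))
    (w : Fin N → ℝ) (e : A × C) : ℝ :=
  bestReward M μ Pl w e.2 (M.arrive e.1)

/-- The policies that use only plans in `Pl S` when packets arrive for `S`. -/
def policiesUsing (M : System N A C) (Pl : Finset (Fin N) → Set (Plan M)) : Set (Policy M) :=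
  {η | ∀ k h c S, ∀ f ∈ (η.plan k h c S).support, f ∈ Pl S}

variable {M : System N A C} {μ : Decrease M} {Pl : Finset (Fin N) → Set (Plan M)}

lemma reward_le_bestReward (w : Fin N → ℝ) (c : C) {S : Finset (Fin N)} {f : Plan M}
    (hf : f ∈ Pl S) : reward M μ w c S f ≤ bestReward M μ Pl w c S :=
  le_ciSup (f := fun f : Pl S => reward M μ w c S f) (Set.finite_range _).bddAbove ⟨f, hf⟩

lemma exists_reward_eq_bestReward (hPl : ∀ S, (Pl S).Nonempty) (w : Fin N → ℝ) (c : C)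
    (S : Finset (Fin N)) : ∃ f ∈ Pl S, reward M μ w c S f = bestReward M μ Pl w c S := by
  have : Nonempty (Pl S) := (hPl S).to_subtype
  obtain ⟨f, hf⟩ := exists_eq_ciSup_of_finite (f := fun f : Pl S => reward M μ w c S f)
  exact ⟨f, f.2, hf⟩

lemma bestReward_le_add (hPl : ∀ S, (Pl S).Nonempty) (hμ0 : ∀ n c x, 0 ≤ μ n c x) {B : ℝ}
    (hμB : ∀ n c x, μ n c x ≤ B) {w w' : Fin N → ℝ} {d : ℝ} (hd : 0 ≤ d)
    (hw : ∀ n, w n ≤ w' n + d) (c : C) (S : Finset (Fin N)) :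
    bestReward M μ Pl w c S ≤ bestReward M μ Pl w' c S + N * (d * B) := by
  have : Nonempty (Pl S) := (hPl S).to_subtype
  refine ciSup_le fun f => le_trans ?_ (add_le_add_left (reward_le_bestReward w' c f.2) _)
  rw [reward, reward, ← expect_const (run M c S f) (N * (d * B)), ← expect_add]
  refine expect_mono fun tr => ?_
  have h1 : (N : ℝ) * (d * B) = ∑ _n : Fin N, d * B := by simp
  rw [h1, ← Finset.sum_add_distrib]
  refine Finset.sum_le_sum fun n _ => ?_
  have h2 : 0 ≤ decrease M μ n (S, c, tr) := hμ0 _ _ _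
  have h3 : decrease M μ n (S, c, tr) ≤ B := hμB _ _ _
  nlinarith [mul_le_mul_of_nonneg_right (hw n) h2, mul_le_mul_of_nonneg_left h3 hd]

/-- For fixed weights, a policy restricted to the plans in `Pl` earns at most the best reward in
period `j`, whatever it does before. -/
lemma expect_startsIn_mul_decrease_le {η : Policy M} (hη : η ∈ policiesUsing M Pl)
    (w : Fin N → ℝ) (e : A × C) (j : ℕ) :
    (expect (law M η (j + 1)) fun h =>
        startsIn M e h * ∑ n, w n * decrease M μ n (observe M (h (Fin.last j)))) ≤
      envProb M e * (envOp M)^[j] (envReward M μ Pl w) e := by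
  rw [← expect_startsIn_mul_env M η, expect_law_succ, expect_law_succ]
  refine expect_mono fun h => expect_mono fun e' => expect_mono_of_support fun f hf => ?_
  obtain ⟨x, hx0, hx⟩ : ∃ x : ℝ, 0 ≤ x ∧ ∀ tr,
      startsIn M e (Fin.snoc h (e'.1, e'.2, tr) : Fin (j + 1) → Outcome M) = x := by
    refine ⟨startsIn M e (Fin.snoc h (e'.1, e'.2, fun _ => none) : Fin (j + 1) → Outcome M),
      startsIn_nonneg M e _, fun tr => ?_⟩
    cases j with
    | zero =>
      have hl : ∀ tr, (Fin.snoc h (e'.1, e'.2, tr) : Fin (0 + 1) → Outcome M) (Fin.last 0) =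
        (e'.1, e'.2, tr) := fun tr => Fin.snoc_last _ _
      rw [startsIn_one, startsIn_one, hl, hl]
      rfl
    | succ j => simp only [startsIn_succ, Fin.init_snoc]
  simp only [hx, Fin.snoc_last, expect_const_mul]
  refine mul_le_mul_of_nonneg_left ?_ hx0
  exact (reward_le_bestReward w e'.2 (hη _ _ _ _ f hf)).trans_eq (expect_const _ _).symm

end Reward

/-! ### Debts -/

section Debts

/-- The debts after a history of outcomes. -/
def debts (M : System N A C) (z : Fin N → ℝ →ₗ[ℝ] ℝ) (μ : Decrease M) (q : Fin N → ℝ)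
    {k : ℕ} (h : Fin k → Outcome M) (n : Fin N) : ℝ :=
  debt M z μ q n fun j => observe M (h j)

/-- The positive parts of the debts after a history of outcomes. -/
def posDebts (M : System N A C) (z : Fin N → ℝ →ₗ[ℝ] ℝ) (μ : Decrease M) (q : Fin N → ℝ)
    {k : ℕ} (h : Fin k → Outcome M) (n : Fin N) : ℝ :=
  max (debts M z μ q h n) 0

variable {M : System N A C} {z : Fin N → ℝ →ₗ[ℝ] ℝ} {μ : Decrease M} {q : Fin N → ℝ}

lemma debts_succ {k : ℕ} (h : Fin (k + 1) → Outcome M) (n : Fin N) :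
    debts M z μ q h n = debts M z μ q (Fin.init h) n + z n (q n) -
      decrease M μ n (observe M (h (Fin.last k))) := rfl

lemma debts_le (hμ0 : ∀ n c x, 0 ≤ μ n c x) {k : ℕ} (h : Fin k → Outcome M) (n : Fin N) :
    debts M z μ q h n ≤ k * z n (q n) := by
  induction k with
  | zero => simp [debts, debt]
  | succ k ih =>
    have h1 := ih (Fin.init h)
    have h2 : 0 ≤ decrease M μ n (observe M (h (Fin.last k))) := hμ0 _ _ _
    rw [debts_succ]
    push_cast
    linarith

lemma posDebts_nonneg {k : ℕ} (h : Fin k → Outcome M) (n : Fin N) : 0 ≤ posDebts M z μ q h n :=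
  le_max_right _ _

end Debts

/-! ### A horizon over which the best rewards dominate -/

section Horizon

variable {M : System N A C} {z : Fin N → ℝ →ₗ[ℝ] ℝ} {μ : Decrease M} {q : Fin N → ℝ}
  {Pl : Finset (Fin N) → Set (Plan M)}

/-- The total weighted decrease in the first `m` periods is at most what the best rewards for the
fixed weights `w` add up to. -/
lemma expect_startsIn_mul_total_le {η : Policy M} (hη : η ∈ policiesUsing M Pl)
    (w : Fin N → ℝ) (e : A × C) (m : ℕ) :
    (expect (law M η m) fun h =>
        startsIn M e h * ∑ n, w n * (m * z n (q n) - debts M z μ q h n)) ≤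
      envProb M e * ∑ j ∈ Finset.range m, (envOp M)^[j] (envReward M μ Pl w) e := by
  induction m with
  | zero =>
    rw [show law M η 0 = PMF.pure Fin.elim0 from rfl, expect_pure]
    simp [debts, debt]
  | succ m ih =>
    have hpt (h : Fin (m + 1) → Outcome M) :
        startsIn M e h * ∑ n, w n * (((m + 1 : ℕ) : ℝ) * z n (q n) - debts M z μ q h n) =
          startsIn M e (Fin.init h) *
              (∑ n, w n * (m * z n (q n) - debts M z μ q (Fin.init h) n)) +
            startsIn M e h * ∑ n, w n * decrease M μ n (observe M (h (Fin.last m))) := by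
      have h1 : startsIn M e (Fin.init h) *
          (∑ n, w n * (m * z n (q n) - debts M z μ q (Fin.init h) n)) = startsIn M e h *
          (∑ n, w n * (m * z n (q n) - debts M z μ q (Fin.init h) n)) := by
        cases m with
        | zero => simp [debts, debt]
        | succ m => rw [startsIn_succ]
      rw [h1, ← mul_add, ← Finset.sum_add_distrib]
      congr 1
      refine Finset.sum_congr rfl fun n _ => ?_
      rw [debts_succ]
      push_cast
      ring
    simp only [hpt]
    rw [expect_add, expect_law_init M η m fun h => startsIn M e h *
      ∑ n, w n * (m * z n (q n) - debts M z μ q h n), Finset.sum_range_succ, mul_add]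
    exact add_le_add ih (expect_startsIn_mul_decrease_le hη w e m)

/-- If some policy keeps the debts for the requirements `q` from growing linearly, then from every
initial environment the total decrease of each client exceeds any smaller rate. -/
lemma eventually_le_expect_startsIn_mul (hμ0 : ∀ n c x, 0 ≤ μ n c x) {η : Policy M} (n : Fin N)
    (hη : ∀ ε : ℝ, 0 < ε → Tendsto (fun k : ℕ => prob (law M η k)
      {h | debt M z μ q n (fun j => observe M (h j)) / (k : ℝ) < ε}) atTop (𝓝 1))
    {ζ : ℝ} (hζ0 : 0 ≤ ζ) (hζ : ζ < z n (q n)) (e : A × C) :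
    ∀ᶠ m : ℕ in atTop, envProb M e * (m * ζ) ≤
      expect (law M η m) fun h => startsIn M e h * (m * z n (q n) - debts M z μ q h n) := by
  have hπ := envProb_pos M e
  set ε : ℝ := (z n (q n) - ζ) / 2 with hε
  set κ : ℝ := z n (q n) - ε with hκ
  have hε0 : 0 < ε := by rw [hε]; linarith
  have hκζ : ζ < κ := by rw [hκ, hε]; linarith
  have hκ0 : 0 ≤ κ := hζ0.trans hκζ.le
  have hlim : Tendsto (fun k : ℕ => κ * (envProb M e + (prob (law M η k)
      {h | debt M z μ q n (fun j => observe M (h j)) / (k : ℝ) < ε} - 1))) atTop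
      (𝓝 (κ * (envProb M e + (1 - 1)))) :=
    (((hη ε hε0).sub_const 1).const_add _).const_mul κ
  have hlt : envProb M e * ζ < κ * (envProb M e + (1 - 1)) := by nlinarith
  filter_upwards [hlim.eventually (lt_mem_nhds hlt), eventually_ge_atTop 1] with m hm hm1
  obtain ⟨k, rfl⟩ : ∃ k, m = k + 1 := ⟨m - 1, by omega⟩
  have hk : (0 : ℝ) < ((k + 1 : ℕ) : ℝ) := by positivity
  calc envProb M e * (((k + 1 : ℕ) : ℝ) * ζ)
      = ((k + 1 : ℕ) : ℝ) * (envProb M e * ζ) := by ring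
    _ ≤ ((k + 1 : ℕ) : ℝ) * (κ * (envProb M e + (prob (law M η (k + 1))
          {h | debt M z μ q n (fun j => observe M (h j)) / ((k + 1 : ℕ) : ℝ) < ε} - 1))) :=
        mul_le_mul_of_nonneg_left hm.le hk.le
    _ = expect (law M η (k + 1)) fun h => (((k + 1 : ℕ) : ℝ) * κ) * (startsIn M e h +
          ({h | debt M z μ q n (fun j => observe M (h j)) / ((k + 1 : ℕ) : ℝ) < ε}.indicator
            (fun _ => 1) h - 1)) := by
        rw [expect_const_mul, expect_add, expect_sub, expect_const, expect_startsIn, prob]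
        ring
    _ ≤ _ := by
        -- The lower bound is positive only on histories that start in `e` and satisfy the event.
        refine expect_mono fun h => ?_
        have hy : 0 ≤ ((k + 1 : ℕ) : ℝ) * z n (q n) - debts M z μ q h n :=
          sub_nonneg.2 (debts_le hμ0 h n)
        have hkκ : 0 ≤ ((k + 1 : ℕ) : ℝ) * κ := mul_nonneg hk.le hκ0
        have hs : startsIn M e h = 0 ∨ startsIn M e h = 1 := by
          unfold startsIn
          split_ifs <;> simp
        by_cases hE : debt M z μ q n (fun j => observe M (h j)) / ((k + 1 : ℕ) : ℝ) < ε
        · have h1 : debts M z μ q h n < ε * ((k + 1 : ℕ) : ℝ) := (div_lt_iff₀ hk).1 hE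
          simp only [Set.indicator, Set.mem_ofPred_eq, hE, if_true, sub_self, add_zero]
          rcases hs with hs | hs <;> rw [hs]
          · simp
          · rw [hκ]
            nlinarith
        · simp only [Set.indicator, Set.mem_ofPred_eq, hE, if_false]
          rcases hs with hs | hs <;> rw [hs]
          · nlinarith
          · simpa using hy

/-- If some policy with plans in `Pl` keeps the debts for the requirements `q` from growing
linearly, then for a suitable horizon `m` the best rewards for arbitrary fixed weights, summed over
`m` periods, dominate any smaller rates from every initial environment. -/
lemma exists_horizon (hμ0 : ∀ n c x, 0 ≤ μ n c x) {η : Policy M} (hηP : η ∈ policiesUsing M Pl)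
    (hη : ∀ n, ∀ ε : ℝ, 0 < ε → Tendsto (fun k : ℕ => prob (law M η k)
      {h | debt M z μ q n (fun j => observe M (h j)) / (k : ℝ) < ε}) atTop (𝓝 1))
    {ζ : Fin N → ℝ} (hζ0 : ∀ n, 0 ≤ ζ n) (hζ : ∀ n, ζ n < z n (q n)) :
    ∃ m : ℕ, 0 < m ∧ ∀ w : Fin N → ℝ, (∀ n, 0 ≤ w n) → ∀ e,
      m * ∑ n, ζ n * w n ≤ ∑ j ∈ Finset.range m, (envOp M)^[j] (envReward M μ Pl w) e := by
  have hev : ∀ᶠ m : ℕ in atTop, ∀ n, ∀ e, envProb M e * (m * ζ n) ≤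
      expect (law M η m) fun h => startsIn M e h * (m * z n (q n) - debts M z μ q h n) :=
    eventually_all.2 fun n => eventually_all.2 fun e =>
      eventually_le_expect_startsIn_mul hμ0 n (hη n) (hζ0 n) (hζ n) e
  obtain ⟨m, hm, hm0⟩ := (hev.and (eventually_gt_atTop 0)).exists
  refine ⟨m, hm0, fun w hw e => le_of_mul_le_mul_left ?_ (envProb_pos M e)⟩
  refine le_trans ?_ (expect_startsIn_mul_total_le (z := z) (q := q) hηP w e m)
  calc envProb M e * (m * ∑ n, ζ n * w n) = ∑ n, w n * (envProb M e * (m * ζ n)) := by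
        simp only [Finset.mul_sum]
        exact Finset.sum_congr rfl fun n _ => by ring
    _ ≤ ∑ n, w n * expect (law M η m) fun h =>
          startsIn M e h * (m * z n (q n) - debts M z μ q h n) :=
        Finset.sum_le_sum fun n _ => mul_le_mul_of_nonneg_left (hm n e) (hw n)
    _ = _ := by
        simp only [← expect_const_mul, ← expect_sum]
        congr 1
        funext h
        rw [Finset.mul_sum]
        exact Finset.sum_congr rfl fun n _ => by ring

end Horizon

/-! ### Policies that maximize the payoff -/

section Payoff

variable {M : System N A C} {z : Fin N → ℝ →ₗ[ℝ] ℝ} {μ : Decrease M} {q : Fin N → ℝ}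
  {Pl : Finset (Fin N) → Set (Plan M)}

/-- What the scheduler conditions on at the beginning of a period: channel state, arrivals and
debts. -/
def stateKey (M : System N A C) (z : Fin N → ℝ →ₗ[ℝ] ℝ) (μ : Decrease M) (q : Fin N → ℝ)
    {k : ℕ} (h : Fin k → Outcome M) (e : A × C) : C × Finset (Fin N) × (Fin N → ℝ) :=
  (e.2, M.arrive e.1, debts M z μ q h)

/-- The weighted decrease in the last period, the weights being the positive parts of the debts at
its beginning. -/
def lastGain (M : System N A C) (z : Fin N → ℝ →ₗ[ℝ] ℝ) (μ : Decrease M) (q : Fin N → ℝ)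
    {k : ℕ} (h : Fin (k + 1) → Outcome M) : ℝ :=
  ∑ n, posDebts M z μ q (Fin.init h) n * decrease M μ n (observe M (h (Fin.last k)))

lemma stateEvent_eq (k : ℕ) (c : C) (S : Finset (Fin N)) (ρ : Fin N → ℝ) :
    stateEvent M z μ q k c S ρ =
      {h | stateKey M z μ q (Fin.init h) (env M (h (Fin.last k))) = (c, S, ρ)} := by
  ext h
  simp only [stateEvent, stateKey, env, Set.mem_ofPred_eq, Prod.mk.injEq, funext_iff]
  rfl

lemma payoff_eq (η : Policy M) (k : ℕ) (c : C) (S : Finset (Fin N)) (ρ : Fin N → ℝ) :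
    payoff M z μ q η k c S ρ =
      expect (law M η (k + 1)) ((stateEvent M z μ q k c S ρ).indicator (lastGain M z μ q)) /
        prob (law M η (k + 1)) (stateEvent M z μ q k c S ρ) := by
  simp only [payoff, condExpect]
  rw [← Finset.sum_div, ← expect_sum]
  congr 2
  funext h
  by_cases hh : h ∈ stateEvent M z μ q k c S ρ
  · simp only [Set.indicator_of_mem hh]
    rfl
  · simp only [Set.indicator_of_notMem hh, Finset.sum_const_zero]

/-- A policy that maximizes the conditional payoffs earns, in expectation over the whole past, at
least the best reward for the weights given by the current debts. -/
lemma expect_envReward_le_expect_lastGain (hPl : ∀ S, (Pl S).Nonempty) {η : Policy M}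
    (hη : MaximizesPayoff M (policiesUsing M Pl) z μ q η) (k : ℕ) :
    (expect (law M η k) fun h => expect (envLaw M h) (envReward M μ Pl (posDebts M z μ q h))) ≤
      expect (law M η (k + 1)) (lastGain M z μ q) := by
  classical
  choose best hbest hbest_eq using
    fun w c S => exists_reward_eq_bestReward (μ := μ) hPl w c S
  -- The competitor departs from `η` in period `k` only, where it plays a best plan for the debts.
  let η' : Policy M := ⟨fun j => if hj : j = k then
    fun h c S => PMF.pure (best (fun n => max (debt M z μ q n h) 0) c S) else η.plan j⟩
  have hη'k (h : Fin k → Obs M) (c : C) (S : Finset (Fin N)) :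
      η'.plan k h c S = PMF.pure (best (fun n => max (debt M z μ q n h) 0) c S) := by
    simp [η']
  have hη'ne {j : ℕ} (hj : j ≠ k) : η'.plan j = η.plan j := by simp [η', hj]
  have hη'P : η' ∈ policiesUsing M Pl := by
    intro j h c S f hf
    by_cases hj : j = k
    · subst hj
      rw [hη'k, PMF.support_pure] at hf
      rw [Set.mem_singleton_iff.1 hf]
      exact hbest _ _ _
    · rw [hη'ne hj] at hf
      exact hη.1 j h c S f hf
  have hpast : ∀ j < k, η'.plan j = η.plan j := fun j hj => hη'ne hj.ne
  have hprob (c : C) (S : Finset (Fin N)) (ρ : Fin N → ℝ) :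
      prob (law M η' (k + 1)) (stateEvent M z μ q k c S ρ) =
        prob (law M η (k + 1)) (stateEvent M z μ q k c S ρ) := by
    have hlaw (η : Policy M) : prob (law M η (k + 1)) (stateEvent M z μ q k c S ρ) =
        expect (law M η k) fun h => expect (envLaw M h)
          ({e | stateKey M z μ q h e = (c, S, ρ)}.indicator fun _ => 1) := by
      rw [stateEvent_eq]
      exact expect_law_env M η k fun h =>
        ({e | stateKey M z μ q h e = (c, S, ρ)}.indicator fun _ => 1)
    rw [hlaw, hlaw, law_congr M hpast]
  have hgain : expect (law M η' (k + 1)) (lastGain M z μ q) =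
      expect (law M η k) fun h =>
        expect (envLaw M h) (envReward M μ Pl (posDebts M z μ q h)) := by
    rw [expect_law_succ, law_congr M hpast]
    congr 1
    funext h
    congr 1
    funext e
    rw [hη'k, expect_pure, envReward, ← hbest_eq]
    simp only [lastGain, Fin.init_snoc, Fin.snoc_last]
    rfl
  rw [← hgain, expect_eq_sum_fiber _ fun h : Fin (k + 1) → Outcome M =>
      stateKey M z μ q (Fin.init h) (env M (h (Fin.last k))),
    expect_eq_sum_fiber (law M η (k + 1)) fun h : Fin (k + 1) → Outcome M =>
      stateKey M z μ q (Fin.init h) (env M (h (Fin.last k)))]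
  -- On each event that the payoff is conditioned on, the denominators agree by `hprob`.
  refine Finset.sum_le_sum fun y _ => ?_
  obtain ⟨c, S, ρ⟩ := y
  rw [← stateEvent_eq]
  have h0 : 0 ≤ prob (law M η (k + 1)) (stateEvent M z μ q k c S ρ) :=
    expect_nonneg (Set.indicator_nonneg fun _ _ => zero_le_one)
  rcases h0.eq_or_lt with h0 | h0
  · rw [expect_indicator_eq_zero h0.symm, expect_indicator_eq_zero ((hprob c S ρ).trans h0.symm)]
  · have h1 := hη.2 k η' hη'P hpast c S ρ h0
    rw [payoff_eq, payoff_eq, hprob] at h1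
    exact (div_le_div_iff_of_pos_right h0).1 h1

end Payoff

/-! ### Linear growth from a drift condition -/

section Growth

/-- A quantity that increases by at most `D` over every `m` steps grows at most linearly. -/
lemma exists_le_add_mul {E : ℕ → ℝ} (hE : ∀ k, 0 ≤ E k) {m : ℕ} (hm : 0 < m) {D : ℝ}
    (hD : 0 ≤ D) (h : ∀ k, E (k + m) ≤ E k + D) : ∃ D₀, ∀ k : ℕ, E k ≤ D₀ + k * D := by
  refine ⟨∑ j ∈ Finset.range m, E j, fun k => ?_⟩
  induction k using Nat.strong_induction_on with
  | _ k ih =>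
    by_cases hk : k < m
    · have h1 : E k ≤ ∑ j ∈ Finset.range m, E j :=
        Finset.single_le_sum (fun j _ => hE j) (Finset.mem_range.2 hk)
      have h2 : 0 ≤ k * D := by positivity
      linarith
    · obtain ⟨l, rfl⟩ : ∃ l, k = l + m := ⟨k - m, by omega⟩
      have h1 := ih l (by omega)
      have h2 := h l
      have h3 : (1 : ℝ) ≤ m := by exact_mod_cast hm
      push_cast
      nlinarith

/-- Drift over `m` steps: here `E k` is the Lyapunov function, `Y k` the expected growth of the
debts and `X k j` the best decrease in period `k + j` for weights that are frozen in period `k`. -/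
lemma le_add_of_drift {E Y : ℕ → ℝ} {X : ℕ → ℕ → ℝ} {c : ℝ}
    (hE : ∀ k, E (k + 1) ≤ E k + 2 * (Y k - X k 0) + c) (hY : ∀ k, Y (k + 1) ≤ Y k + c)
    (hX : ∀ k i, X k (i + 1) ≤ X (k + 1) i + c) {m : ℕ}
    (hm : ∀ k, m * Y k ≤ ∑ j ∈ Finset.range m, X k j) (k : ℕ) :
    E (k + m) ≤ E k + ∑ j ∈ Finset.range m, (4 * (j * c) + c) := by
  have hY' (j : ℕ) : Y (k + j) ≤ Y k + j * c := by
    induction j with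
    | zero => simp
    | succ j ih =>
      have := hY (k + j)
      rw [← add_assoc]
      push_cast
      linarith
  have hX' (j : ℕ) : ∀ i, X k (i + j) ≤ X (k + j) i + j * c := by
    induction j with
    | zero => simp
    | succ j ih =>
      intro i
      have h1 := ih (i + 1)
      have h2 := hX (k + j) i
      rw [add_right_comm] at h1
      rw [← add_assoc, ← add_assoc]
      push_cast
      linarith
  have hsum (l : ℕ) : E (k + l) ≤
      E k + ∑ j ∈ Finset.range l, (2 * (Y k - X k j) + (4 * (j * c) + c)) := by
    induction l with
    | zero => simp
    | succ l ih =>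
      have h1 := hE (k + l)
      have h2 := hY' l
      have h3 := hX' l 0
      rw [zero_add] at h3
      rw [Finset.sum_range_succ, ← add_assoc]
      linarith
  have h1 := hsum m
  rw [Finset.sum_add_distrib, ← Finset.mul_sum, Finset.sum_sub_distrib, Finset.sum_const,
    Finset.card_range, nsmul_eq_mul] at h1
  linarith [hm k]

end Growth

/-! ### The Lyapunov drift -/

section Drift

variable {M : System N A C} {z : Fin N → ℝ →ₗ[ℝ] ℝ} {μ : Decrease M} {q : Fin N → ℝ}
  {Pl : Finset (Fin N) → Set (Plan M)} {K : ℝ}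

lemma posDebts_le_init_add (hμ0 : ∀ n c x, 0 ≤ μ n c x) (hz0 : ∀ n, 0 ≤ z n (q n))
    (hzK : ∀ n, z n (q n) ≤ K) {k : ℕ} (h : Fin (k + 1) → Outcome M) (n : Fin N) :
    posDebts M z μ q h n ≤ posDebts M z μ q (Fin.init h) n + K := by
  have h1 : debts M z μ q (Fin.init h) n ≤ posDebts M z μ q (Fin.init h) n := le_max_left _ _
  have h2 : 0 ≤ posDebts M z μ q (Fin.init h) n := posDebts_nonneg _ n
  have h3 : 0 ≤ decrease M μ n (observe M (h (Fin.last k))) := hμ0 _ _ _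
  have h4 := hz0 n
  have h5 := hzK n
  exact max_le (by rw [debts_succ]; linarith) (by linarith)

lemma posDebts_init_le_add (hμ0 : ∀ n c x, 0 ≤ μ n c x) (hμK : ∀ n c x, μ n c x ≤ K)
    (hz0 : ∀ n, 0 ≤ z n (q n)) {k : ℕ} (h : Fin (k + 1) → Outcome M) (n : Fin N) :
    posDebts M z μ q (Fin.init h) n ≤ posDebts M z μ q h n + K := by
  have h1 : debts M z μ q h n ≤ posDebts M z μ q h n := le_max_left _ _
  have h2 : 0 ≤ posDebts M z μ q h n := posDebts_nonneg _ n
  have h3 : 0 ≤ decrease M μ n (observe M (h (Fin.last k))) := hμ0 _ _ _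
  have h4 : decrease M μ n (observe M (h (Fin.last k))) ≤ K := hμK _ _ _
  have h5 := hz0 n
  rw [debts_succ] at h1
  exact max_le (by linarith) (by linarith)

/-- One-step drift of the Lyapunov function: up to a constant, it is twice the difference between
the weighted growth of the debts and their weighted decrease. -/
lemma sum_sq_posDebts_le (hμ0 : ∀ n c x, 0 ≤ μ n c x) (hμK : ∀ n c x, μ n c x ≤ K)
    (hz0 : ∀ n, 0 ≤ z n (q n)) (hzK : ∀ n, z n (q n) ≤ K) {k : ℕ}
    (h : Fin (k + 1) → Outcome M) :
    ∑ n, posDebts M z μ q h n ^ 2 ≤ (∑ n, posDebts M z μ q (Fin.init h) n ^ 2) +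
      2 * ((∑ n, z n (q n) * posDebts M z μ q (Fin.init h) n) - lastGain M z μ q h) +
        N * (K * K) := by
  have hN : (N : ℝ) * (K * K) = ∑ _n : Fin N, K * K := by simp
  rw [hN, lastGain, ← Finset.sum_sub_distrib, Finset.mul_sum, ← Finset.sum_add_distrib,
    ← Finset.sum_add_distrib]
  refine Finset.sum_le_sum fun n _ => ?_
  have h1 : debts M z μ q (Fin.init h) n ≤ posDebts M z μ q (Fin.init h) n := le_max_left _ _
  have h3 : 0 ≤ decrease M μ n (observe M (h (Fin.last k))) := hμ0 _ _ _
  have h4 : decrease M μ n (observe M (h (Fin.last k))) ≤ K := hμK _ _ _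
  have h5 := hz0 n
  have h6 := hzK n
  have h7 := debts_succ (z := z) (μ := μ) (q := q) h n
  set r := posDebts M z μ q (Fin.init h) n
  set d := decrease M μ n (observe M (h (Fin.last k)))
  have h8 : posDebts M z μ q h n ≤ |r + z n (q n) - d| :=
    max_le (le_trans (by linarith) (le_abs_self _)) (abs_nonneg _)
  have h9 : posDebts M z μ q h n ^ 2 ≤ (r + z n (q n) - d) ^ 2 := by
    rw [← sq_abs (r + z n (q n) - d)]
    exact pow_le_pow_left₀ (posDebts_nonneg h n) h8 2
  have h10 : (z n (q n) - d) ^ 2 ≤ K ^ 2 := sq_le_sq' (by linarith) (by linarith)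
  nlinarith

/-- The expected best reward `i` periods after period `k` for the debts at the beginning of
period `k`. -/
def frozenReward (M : System N A C) (z : Fin N → ℝ →ₗ[ℝ] ℝ) (μ : Decrease M) (q : Fin N → ℝ)
    (Pl : Finset (Fin N) → Set (Plan M)) (η : Policy M) (k i : ℕ) : ℝ :=
  expect (law M η k) fun h =>
    expect (envLaw M h) ((envOp M)^[i] (envReward M μ Pl (posDebts M z μ q h)))

/-- Replacing the weights by the debts one period later costs only a constant, since debts have
bounded increments. -/
lemma frozenReward_succ_le (hPl : ∀ S, (Pl S).Nonempty) (hK : 0 ≤ K)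
    (hμ0 : ∀ n c x, 0 ≤ μ n c x) (hμK : ∀ n c x, μ n c x ≤ K) (hz0 : ∀ n, 0 ≤ z n (q n))
    (η : Policy M) (k i : ℕ) :
    frozenReward M z μ q Pl η k (i + 1) ≤
      frozenReward M z μ q Pl η (k + 1) i + N * (K * K) := by
  have h1 : frozenReward M z μ q Pl η k (i + 1) = expect (law M η (k + 1)) fun h =>
      envOp M ((envOp M)^[i] (envReward M μ Pl (posDebts M z μ q (Fin.init h))))
        (env M (h (Fin.last k))) := by
    rw [expect_law_env M η k fun h =>
      envOp M ((envOp M)^[i] (envReward M μ Pl (posDebts M z μ q h)))]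
    simp only [frozenReward, Function.iterate_succ_apply']
  rw [h1, frozenReward, ← expect_const (law M η (k + 1)) (N * (K * K)), ← expect_add]
  refine expect_mono fun h => ?_
  have h2 (e : A × C) : (envOp M)^[i + 1] (envReward M μ Pl (posDebts M z μ q (Fin.init h))) e ≤
      (envOp M)^[i + 1] (envReward M μ Pl (posDebts M z μ q h)) e + N * (K * K) :=
    envOp_iterate_le_add M (fun e => bestReward_le_add hPl hμ0 hμK hK
      (posDebts_init_le_add hμ0 hμK hz0 h) e.2 (M.arrive e.1)) (i + 1) e
  simp only [Function.iterate_succ_apply'] at h2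
  exact h2 _

lemma expect_weighted_posDebts_succ_le (hμ0 : ∀ n c x, 0 ≤ μ n c x) (hz0 : ∀ n, 0 ≤ z n (q n))
    (hzK : ∀ n, z n (q n) ≤ K) (η : Policy M) (k : ℕ) :
    (expect (law M η (k + 1)) fun h => ∑ n, z n (q n) * posDebts M z μ q h n) ≤
      (expect (law M η k) fun h => ∑ n, z n (q n) * posDebts M z μ q h n) + N * (K * K) := by
  rw [← expect_law_init M η k, ← expect_const (law M η (k + 1)) (N * (K * K)), ← expect_add]
  refine expect_mono fun h => ?_
  have hN : (N : ℝ) * (K * K) = ∑ _n : Fin N, K * K := by simp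
  rw [hN, ← Finset.sum_add_distrib]
  refine Finset.sum_le_sum fun n _ => ?_
  have h1 := posDebts_le_init_add hμ0 hz0 hzK h n
  have h2 := hz0 n
  have h3 := hzK n
  nlinarith [mul_le_mul_of_nonneg_left h1 h2, mul_le_mul_of_nonneg_right h3 (h2.trans h3)]

/-- Under a policy that maximizes the payoff, the expected sum of squares of the positive parts of
the debts grows at most linearly, provided that the best rewards dominate the growth of the debts
over some horizon. -/
lemma exists_expect_sq_posDebts_le (hPl : ∀ S, (Pl S).Nonempty)
    (hμ0 : ∀ n c x, 0 ≤ μ n c x) (hμK : ∀ n c x, μ n c x ≤ K) (hK : 0 ≤ K)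
    (hz0 : ∀ n, 0 ≤ z n (q n)) (hzK : ∀ n, z n (q n) ≤ K) {η : Policy M}
    (hη : MaximizesPayoff M (policiesUsing M Pl) z μ q η) {m : ℕ} (hm0 : 0 < m)
    (hm : ∀ w : Fin N → ℝ, (∀ n, 0 ≤ w n) → ∀ e,
      m * ∑ n, z n (q n) * w n ≤ ∑ j ∈ Finset.range m, (envOp M)^[j] (envReward M μ Pl w) e) :
    ∃ D₀ D : ℝ, ∀ k : ℕ,
      (expect (law M η k) fun h => ∑ n, posDebts M z μ q h n ^ 2) ≤ D₀ + k * D := by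
  have hdrift := le_add_of_drift
    (E := fun k => expect (law M η k) fun h => ∑ n, posDebts M z μ q h n ^ 2)
    (Y := fun k => expect (law M η k) fun h => ∑ n, z n (q n) * posDebts M z μ q h n)
    (X := frozenReward M z μ q Pl η) (c := N * (K * K)) (m := m) (fun k => ?_)
    (expect_weighted_posDebts_succ_le hμ0 hz0 hzK η)
    (frozenReward_succ_le hPl hK hμ0 hμK hz0 η) (fun k => ?_)
  · obtain ⟨D₀, h⟩ := exists_le_add_mul
      (fun k => expect_nonneg fun h => Finset.sum_nonneg fun n _ => sq_nonneg _) hm0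
      (Finset.sum_nonneg fun j _ => by positivity) hdrift
    exact ⟨D₀, _, h⟩
  · have h1 := expect_mono (p := law M η (k + 1))
      fun h => sum_sq_posDebts_le (h := h) hμ0 hμK hz0 hzK
    rw [expect_add, expect_add, expect_const, expect_const_mul, expect_sub,
      expect_law_init M η k fun h => ∑ n, posDebts M z μ q h n ^ 2,
      expect_law_init M η k fun h => ∑ n, z n (q n) * posDebts M z μ q h n] at h1
    have h2 : frozenReward M z μ q Pl η k 0 ≤ expect (law M η (k + 1)) (lastGain M z μ q) :=
      expect_envReward_le_expect_lastGain hPl hη k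
    linarith
  · simp only [frozenReward]
    rw [← expect_sum, ← expect_const_mul]
    refine expect_mono fun h => ?_
    rw [← expect_sum, ← expect_const (envLaw M h) (_ * _)]
    exact expect_mono fun e => hm _ (posDebts_nonneg h) e

lemma tendsto_prob_debt_div_lt {η : Policy M} {D₀ D : ℝ}
    (h : ∀ k : ℕ, (expect (law M η k) fun h => ∑ n, posDebts M z μ q h n ^ 2) ≤ D₀ + k * D)
    (n : Fin N) {ε : ℝ} (hε : 0 < ε) :
    Tendsto (fun k : ℕ => prob (law M η k)
      {h | debt M z μ q n (fun j => observe M (h j)) / (k : ℝ) < ε}) atTop (𝓝 1) := by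
  have hinv : Tendsto (fun k : ℕ => ((k : ℝ))⁻¹) atTop (𝓝 0) := tendsto_inv_atTop_nhds_zero_nat
  have hlow : Tendsto (fun k : ℕ => 1 - (D₀ / ε ^ 2 * ((k : ℝ)⁻¹ * (k : ℝ)⁻¹) +
      D / ε ^ 2 * (k : ℝ)⁻¹)) atTop (𝓝 1) := by
    simpa using (((hinv.mul hinv).const_mul (D₀ / ε ^ 2)).add
      (hinv.const_mul (D / ε ^ 2))).const_sub 1
  refine tendsto_of_tendsto_of_tendsto_of_le_of_le' hlow tendsto_const_nhds ?_
    (Eventually.of_forall fun k => prob_le_one _ _)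
  filter_upwards [eventually_gt_atTop 0] with k hk
  have hk' : (0 : ℝ) < k := by exact_mod_cast hk
  have hset : {h : Fin k → Outcome M | debt M z μ q n (fun j => observe M (h j)) / (k : ℝ) < ε} =
      {h | debts M z μ q h n < ε * k} := by
    ext h
    exact div_lt_iff₀ hk'
  rw [hset]
  refine le_trans ?_ (one_sub_le_prob_lt (law M η k) (fun h => debts M z μ q h n)
    (mul_pos hε hk'))
  have h1 : (expect (law M η k) fun h => max (debts M z μ q h n) 0 ^ 2) ≤ D₀ + k * D :=
    (expect_mono fun h' => Finset.single_le_sum (f := fun n => posDebts M z μ q h' n ^ 2)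
      (fun n _ => sq_nonneg _) (Finset.mem_univ n)).trans (h k)
  have h2 : D₀ / ε ^ 2 * ((k : ℝ)⁻¹ * (k : ℝ)⁻¹) + D / ε ^ 2 * (k : ℝ)⁻¹ =
      (D₀ + k * D) / (ε * k) ^ 2 := by
    field_simp
  rw [h2]
  exact sub_le_sub_left (div_le_div_of_nonneg_right h1 (by positivity)) 1

end Drift

/-! ### Feasibility optimality -/

section Optimality

/-- Both parts of the theorem are instances of this statement: the class of all policies and the
class of priority-based policies are each given by the plans allowed in a single period. -/
theorem feasibilityOptimal_policiesUsing {M : System N A C} {z : Fin N → ℝ →ₗ[ℝ] ℝ}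
    {μ : Decrease M} (hr : IsPseudoDebt M z μ) {Pl : Finset (Fin N) → Set (Plan M)}
    (hPl : ∀ S, (Pl S).Nonempty) {η : (Fin N → ℝ) → Policy M}
    (hη : ∀ q : Fin N → ℝ, (∀ n, 0 < q n) →
      MaximizesPayoff M (policiesUsing M Pl) z μ q (η q)) :
    FeasibilityOptimal M (policiesUsing M Pl) η := by
  rintro q hq ⟨α, hα0, hα1, η₀, hη₀P, hη₀⟩
  have hz0 (n : Fin N) : 0 < z n (q n) := by
    simpa using hr.increasing n (hq n)
  have hlt (n : Fin N) : z n (q n) < z n (q n / α) :=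
    hr.increasing n ((lt_div_iff₀ hα0).2 (mul_lt_of_lt_one_right (hq n) hα1))
  obtain ⟨m, hm0, hm⟩ := exists_horizon (q := fun n => q n / α) hr.nonneg hη₀P
    ((hr.fulfilled_iff η₀ _ fun n => div_pos (hq n) hα0).1 hη₀) (fun n => (hz0 n).le) hlt
  obtain ⟨B, hB⟩ := hr.bounded
  have hsum : 0 ≤ ∑ n, z n (q n) := Finset.sum_nonneg fun n _ => (hz0 n).le
  obtain ⟨D₀, D, hD⟩ := exists_expect_sq_posDebts_le (K := max B 0 + ∑ n, z n (q n)) hPl hr.nonneg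
    (fun n c x => (hB n c x).trans (by linarith [le_max_left B 0]))
    (add_nonneg (le_max_right _ _) hsum) (fun n => (hz0 n).le)
    (fun n => (Finset.single_le_sum (f := fun n => z n (q n)) (fun n _ => (hz0 n).le)
      (Finset.mem_univ n)).trans (le_add_of_nonneg_left (le_max_right _ _))) (hη q hq) hm0 hm
  exact (hr.fulfilled_iff _ q hq).2 fun n ε hε => tendsto_prob_debt_div_lt hD n hε

end Optimality

end Wireless

end

theorem mainTheorem1 {N : ℕ} {A C : Type*} [Fintype A] [Fintype C]
    (M : Wireless.System N A C) (z : Fin N → ℝ →ₗ[ℝ] ℝ) (μ : Wireless.Decrease M)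
    (hr : Wireless.IsPseudoDebt M z μ) :
    (∀ η : (Fin N → ℝ) → Wireless.Policy M,
      (∀ q : Fin N → ℝ, (∀ n, 0 < q n) →
        Wireless.MaximizesPayoff M Set.univ z μ q (η q)) →
      Wireless.FeasibilityOptimal M Set.univ η) ∧
    (∀ η : (Fin N → ℝ) → Wireless.Policy M,
      (∀ q : Fin N → ℝ, (∀ n, 0 < q n) →
        Wireless.MaximizesPayoff M (Wireless.priorityPolicies M) z μ q (η q)) →
      Wireless.FeasibilityOptimal M (Wireless.priorityPolicies M) η) := by
  constructor
  · intro η hη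
    have huniv : (Set.univ : Set (Wireless.Policy M)) =
        Wireless.policiesUsing M fun _ => Set.univ :=
      (Set.eq_univ_of_forall fun η k h c S f _ => Set.mem_univ f).symm
    rw [huniv] at hη ⊢
    exact Wireless.feasibilityOptimal_policiesUsing hr
      (fun _ => ⟨fun _ _ => none, Set.mem_univ _⟩) hη
  · intro η hη
    exact Wireless.feasibilityOptimal_policiesUsing hr
      (Pl := fun S => {f | ∃ order : List (Fin N), order.Nodup ∧
        f = Wireless.priorityPlan M S order})
      (fun S => ⟨_, [], List.nodup_nil, rfl⟩) hη
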